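/- Let $n$ be a natural number and let $f\in C^\infty(\mathbb{R}^n)$ be a convex function with $\lim_{|x|\to\infty} f(x)/|x|=+\infty$. For $\lambda\in\mathbb{R}$ consider the PDE $$\max\{\lambda-\Delta u-f,\ |Du|-1\}=0\quad\text{on }\mathbb{R}^n.\qquad(\ast)$$ An upper semicontinuous function $u:\mathbb{R}^n\to\mathbb{R}$ is a viscosity subsolution of $(\ast)$ with eigenvalue $\lambda$ if $\max\{\lambda-\Delta\varphi(x_0)-f(x_0),|D\varphi(x_0)|-1\}\le 0$ whenever $\varphi\in C^2(\mathbb{R}^n)$ and $u-\varphi$ has a local maximum at $x_0\in\mathbb{R}^n$. A lower semicontinuous function $v:\mathbb{R}^n\to\mathbb{R}$ is a viscosity supersolution of $(\ast)$ with eigenvalue $\mu$ if $\max\{\mu-\Delta\psi(y_0)-f(y_0),|D\psi(y_0)|-1\}\ge 0$ whenever $\psi\in C^2(\mathbb{R}^n)$ and $v-\psi$ has a local minimum at $y_0\in\mathbb{R}^n$. A continuous function is a viscosity solution with eigenvalue $\lambda$ if it is both a viscosity subsolution and a viscosity supersolution with eigenvalue $\lambda$. Then: (i) (Comparison.) If $u$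 is a viscosity subsolution of $(\ast)$ with eigenvalue $\lambda$, $v$ is a viscosity supersolution of $(\ast)$ with eigenvalue $\mu$, and $$\limsup_{|x|\to\infty}\frac{u(x)}{|x|}\le 1\le\liminf_{|x|\to\infty}\frac{v(x)}{|x|},$$ then $\lambda\le\mu$. (ii) (Uniqueness of the eigenvalue.) There is at most one $\lambda\in\mathbb{R}$ such that $(\ast)$ has a viscosity solution $u$ with eigenvalue $\lambda$ satisfying $\lim_{|x|\to\infty}u(x)/|x|=1$. -/

import Mathlib

open Filter Topology
open scoped ContDiff Gradient Laplacian

/-- The operator `max {lam - Δφ(x) - f(x), |Dφ(x)| - 1}` of the eigenvalue problem,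
evaluated at the point `x` on a `C²` function `φ`. -/
noncomputable def eigenOp {n : ℕ} (f : EuclideanSpace ℝ (Fin n) → ℝ) (lam : ℝ)
    (φ : EuclideanSpace ℝ (Fin n) → ℝ) (x : EuclideanSpace ℝ (Fin n)) : ℝ :=
  max (lam - (Δ φ) x - f x) (‖∇ φ x‖ - 1)

/-- `u` is a viscosity subsolution of `max {lam - Δu - f, |Du| - 1} = 0` on `ℝⁿ`
with eigenvalue `lam`. -/
def IsViscositySubsolution {n : ℕ} (f : EuclideanSpace ℝ (Fin n) → ℝ) (lam : ℝ)
    (u : EuclideanSpace ℝ (Fin n) → ℝ) : Prop :=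
  UpperSemicontinuous u ∧
    ∀ (x₀ : EuclideanSpace ℝ (Fin n)) (φ : EuclideanSpace ℝ (Fin n) → ℝ),
      ContDiff ℝ 2 φ → IsLocalMax (fun x => u x - φ x) x₀ → eigenOp f lam φ x₀ ≤ 0

/-- `v` is a viscosity supersolution of `max {mu - Δv - f, |Dv| - 1} = 0` on `ℝⁿ`
with eigenvalue `mu`. -/
def IsViscositySupersolution {n : ℕ} (f : EuclideanSpace ℝ (Fin n) → ℝ) (mu : ℝ)
    (v : EuclideanSpace ℝ (Fin n) → ℝ) : Prop :=
  LowerSemicontinuous v ∧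
    ∀ (y₀ : EuclideanSpace ℝ (Fin n)) (ψ : EuclideanSpace ℝ (Fin n) → ℝ),
      ContDiff ℝ 2 ψ → IsLocalMin (fun y => v y - ψ y) y₀ → 0 ≤ eigenOp f mu ψ y₀

/-- `u` is a (continuous) viscosity solution of `max {lam - Δu - f, |Du| - 1} = 0` on `ℝⁿ`
with eigenvalue `lam`. -/
def IsViscositySolution {n : ℕ} (f : EuclideanSpace ℝ (Fin n) → ℝ) (lam : ℝ)
    (u : EuclideanSpace ℝ (Fin n) → ℝ) : Prop :=
  Continuous u ∧ IsViscositySubsolution f lam u ∧ IsViscositySupersolution f lam u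

/-!
The subsolution `u` is regularized by a procedure that keeps both of its inequalities, and the
regularization, scaled by `τ < 1`, serves as a smooth test function for the supersolution `v`. No
doubling of variables and no theorem on sums is needed, because both inequalities for `u` are
convex in `u`.

The gradient constraint and the growth of `u` make `u` globally `1`-Lipschitz
(`IsViscositySubsolution.sub_le_norm`). For such `u` there are smooth `1`-Lipschitz functions `V`
with `V - ε Δ V ≈ u` (`exists_smooth_resolvent`): the equation with second differences in place of
the Laplacian is solved by iterating convex combinations of translates, which preserves Lipschitz
bounds, and the result is mollified. Testing the subsolution property of `u` with `V` gives
`u ≤ V - ε (lam - f)` up to `o(ε)`, that is, `Δ V ≥ lam - f - o(1)` locally uniformly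
(`IsViscositySubsolution.le_laplacian_resolvent`).

By the growth of `v`, the function `v - τ V` attains its minimum at some `y` in a ball that does not
depend on `V`. Since `‖∇ (τ V)‖ ≤ τ < 1`, the supersolution property at `y` reads
`mu ≥ τ Δ V y + f y ≥ τ lam + (1 - τ) f y - o(1)`. As `f` is bounded below, letting the errors tend
to `0` and then `τ → 1` gives `lam ≤ mu` (`eigenvalue_le`). Uniqueness of the eigenvalue is this
comparison applied in both directions.
-/

section

open MeasureTheory
open scoped Convolution

variable {n : ℕ}

/-! ### The discrete resolvent -/

/-- The sum over the coordinate directions of the second differences of `w` at `x` with step `h`;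
it approximates `h ^ 2 * Δ w x`. There is no division by `h ^ 2`. -/
noncomputable def secondDiff (h : ℝ) (w : EuclideanSpace ℝ (Fin n) → ℝ)
    (x : EuclideanSpace ℝ (Fin n)) : ℝ :=
  ∑ i, (w (x + h • EuclideanSpace.basisFun (Fin n) ℝ i) +
    w (x - h • EuclideanSpace.basisFun (Fin n) ℝ i) - 2 * w x)

/-- One step of the fixed-point iteration for the discrete resolvent equation
`w - a * secondDiff h w = u`, solved for the diagonal term: a convex combination of `u x` and the
values of `w` at the `2 * n` neighbours of `x` at distance `h`. -/
noncomputable def resolventStep (a h : ℝ) (u w : EuclideanSpace ℝ (Fin n) → ℝ)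
    (x : EuclideanSpace ℝ (Fin n)) : ℝ :=
  (u x + a * ∑ i, (w (x + h • EuclideanSpace.basisFun (Fin n) ℝ i) +
    w (x - h • EuclideanSpace.basisFun (Fin n) ℝ i))) / (1 + 2 * n * a)


/-- The residual of the discrete resolvent equation is a multiple of the increment of the
iteration. -/
theorem sub_secondDiff_eq_resolventStep {a h : ℝ} (ha : 0 ≤ a)
    (u w : EuclideanSpace ℝ (Fin n) → ℝ) (x : EuclideanSpace ℝ (Fin n)) :
    w x - a * secondDiff h w x - u x = (1 + 2 * n * a) * (w x - resolventStep a h u w x) := by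
  have : (1 + 2 * n * a) ≠ 0 := by positivity
  rw [secondDiff, resolventStep, mul_sub, mul_div_cancel₀ _ this, Finset.sum_sub_distrib]
  simp only [Finset.sum_const, Finset.card_univ, Fintype.card_fin, nsmul_eq_mul]
  ring

/-- Comparing two steps at different points covers both the Lipschitz bound (`w = w'`) and the
contraction estimate (`x = x'`). -/
theorem resolventStep_sub_le {a h c d : ℝ} (ha : 0 ≤ a)
    {u u' w w' : EuclideanSpace ℝ (Fin n) → ℝ} {x x' : EuclideanSpace ℝ (Fin n)}
    (hu : u x - u' x' ≤ d) (hw : ∀ y, w (x + y) - w' (x' + y) ≤ c) :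
    resolventStep a h u w x - resolventStep a h u' w' x' ≤
      (d + 2 * n * a * c) / (1 + 2 * n * a) := by
  rw [resolventStep, resolventStep, ← sub_div]
  gcongr
  have : ∑ i, (w (x + h • EuclideanSpace.basisFun (Fin n) ℝ i) +
      w (x - h • EuclideanSpace.basisFun (Fin n) ℝ i)) -
      ∑ i, (w' (x' + h • EuclideanSpace.basisFun (Fin n) ℝ i) +
      w' (x' - h • EuclideanSpace.basisFun (Fin n) ℝ i)) ≤ ∑ i : Fin n, 2 * c := by
    rw [← Finset.sum_sub_distrib]
    refine Finset.sum_le_sum fun i _ => ?_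
    have h1 := hw (h • EuclideanSpace.basisFun (Fin n) ℝ i)
    have h2 := hw (-(h • EuclideanSpace.basisFun (Fin n) ℝ i))
    simp only [← sub_eq_add_neg] at h2
    linarith
  simp only [Finset.sum_const, Finset.card_univ, Fintype.card_fin, nsmul_eq_mul] at this
  nlinarith [mul_le_mul_of_nonneg_left this ha]

theorem sum_sq_norm_add_sub (h : ℝ) (z : EuclideanSpace ℝ (Fin n)) :
    ∑ i, (‖z + h • EuclideanSpace.basisFun (Fin n) ℝ i‖ ^ 2 +
      ‖z - h • EuclideanSpace.basisFun (Fin n) ℝ i‖ ^ 2) = 2 * n * ‖z‖ ^ 2 + 2 * n * h ^ 2 := by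
  have (i : Fin n) : ‖z + h • EuclideanSpace.basisFun (Fin n) ℝ i‖ ^ 2 +
      ‖z - h • EuclideanSpace.basisFun (Fin n) ℝ i‖ ^ 2 = 2 * ‖z‖ ^ 2 + 2 * h ^ 2 := by
    have := parallelogram_law_with_norm ℝ z (h • EuclideanSpace.basisFun (Fin n) ℝ i)
    rw [this, norm_smul, (EuclideanSpace.basisFun (Fin n) ℝ).norm_eq_one, mul_one,
      Real.norm_eq_abs, sq_abs, mul_add]
  simp only [this, Finset.sum_const, Finset.card_univ, Fintype.card_fin, nsmul_eq_mul]
  ring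

/-- Approximate solutions `w` of `w - a * secondDiff h w = u` which are again `1`-Lipschitz. The last
conclusion bounds `u - w` in terms of `a * h ^ 2` only; the Lipschitz bound along the iteration
alone would give an estimate that blows up as `h → 0` with `a * h ^ 2` fixed. -/
theorem exists_discrete_resolvent {u : EuclideanSpace ℝ (Fin n) → ℝ}
    (hu : ∀ x y, u x - u y ≤ ‖x - y‖) {a h η : ℝ} (ha : 0 ≤ a) (hh : 0 ≤ h) (hη : 0 < η) :
    ∃ w : EuclideanSpace ℝ (Fin n) → ℝ, (∀ x y, w x - w y ≤ ‖x - y‖) ∧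
      (∀ x, |w x - a * secondDiff h w x - u x| ≤ η) ∧
      ∀ σ > 0, ∀ x, u x ≤ w x + σ + n * (a * h ^ 2) / (2 * σ) := by
  set w : ℕ → EuclideanSpace ℝ (Fin n) → ℝ := fun k => (resolventStep a h u)^[k] u with hwdef
  have w0 : w 0 = u := rfl
  have wS (k : ℕ) : w (k + 1) = resolventStep a h u (w k) := Function.iterate_succ_apply' _ _ _
  set N : ℝ := 1 + 2 * n * a with hN
  have hNpos : 0 < N := by positivity
  have hlip (k : ℕ) : ∀ x y, w k x - w k y ≤ ‖x - y‖ := by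
    induction k with
    | zero => exact hu
    | succ k ih =>
      intro x y
      rw [wS]
      refine (resolventStep_sub_le ha (hu x y) (c := ‖x - y‖) fun z => ?_).trans (le_of_eq ?_)
      · simpa using ih (x + z) (y + z)
      · rw [div_eq_iff hNpos.ne']; ring
  set θ : ℝ := 2 * n * a / N with hθ
  have hθ0 : 0 ≤ θ := by positivity
  have hθ1 : θ < 1 := by rw [hθ, div_lt_one hNpos]; linarith
  have hstep (f g : EuclideanSpace ℝ (Fin n) → ℝ) (c : ℝ) (hfg : ∀ x, f x - g x ≤ c) (x) :
      resolventStep a h u f x - resolventStep a h u g x ≤ θ * c := by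
    refine (resolventStep_sub_le ha (sub_self (u x)).le (c := c) fun y => hfg _).trans
      (le_of_eq ?_)
    rw [hθ]; ring
  have hdist (k : ℕ) : ∀ x, w (k + 1) x - w k x ≤ θ ^ k * h ∧ w k x - w (k + 1) x ≤ θ ^ k * h := by
    induction k with
    | zero =>
      intro x
      have key := sub_secondDiff_eq_resolventStep (h := h) ha u u x
      have hb : |secondDiff h u x| ≤ ∑ i : Fin n, 2 * h := by
        refine (Finset.abs_sum_le_sum_abs _ _).trans (Finset.sum_le_sum fun i _ => ?_)
        have hnorm : ‖h • EuclideanSpace.basisFun (Fin n) ℝ i‖ = h := by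
          rw [norm_smul, (EuclideanSpace.basisFun (Fin n) ℝ).norm_eq_one, mul_one,
            Real.norm_eq_abs, abs_of_nonneg hh]
        have h1 := hu (x + h • EuclideanSpace.basisFun (Fin n) ℝ i) x
        have h2 := hu x (x + h • EuclideanSpace.basisFun (Fin n) ℝ i)
        have h3 := hu (x - h • EuclideanSpace.basisFun (Fin n) ℝ i) x
        have h4 := hu x (x - h • EuclideanSpace.basisFun (Fin n) ℝ i)
        simp only [add_sub_cancel_left, sub_add_cancel_left, sub_sub_cancel, sub_sub_cancel_left,
          norm_neg, hnorm] at h1 h2 h3 h4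
        rw [abs_le]; constructor <;> linarith
      simp only [Finset.sum_const, Finset.card_univ, Fintype.card_fin, nsmul_eq_mul] at hb
      rw [wS, w0, pow_zero, one_mul]
      have hb' := abs_le.1 (mul_le_mul_of_nonneg_left hb ha |>.trans' (le_of_eq (by
        rw [abs_mul, abs_of_nonneg ha])) : |a * secondDiff h u x| ≤ _)
      constructor
      · refine le_of_mul_le_mul_left ?_ hNpos
        rw [hN]; nlinarith [hb'.1, hb'.2]
      · refine le_of_mul_le_mul_left ?_ hNpos
        rw [hN]; nlinarith [hb'.1, hb'.2]
    | succ k ih =>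
      intro x
      rw [wS (k + 1), pow_succ', mul_assoc]
      -- one occurrence in each conjunct
      nth_rw 2 [wS k]
      nth_rw 2 [wS k]
      exact ⟨hstep _ _ _ (fun y => (ih y).1) x, hstep _ _ _ (fun y => (ih y).2) x⟩
  -- The paraboloid touching `u` from below at `x` is, up to a constant, a subsolution of the
  -- discrete equation, hence stays below every iterate.
  have hlow (k : ℕ) (σ : ℝ) (hσ : 0 < σ) (x : EuclideanSpace ℝ (Fin n)) :
      ∀ y, u x - σ - ‖y - x‖ ^ 2 / (4 * σ) - n * (a * h ^ 2) / (2 * σ) ≤ w k y := by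
    have hbase (y) : u x - σ - ‖y - x‖ ^ 2 / (4 * σ) ≤ u y := by
      have h1 := hu x y
      rw [norm_sub_rev] at h1
      have h2 : ‖y - x‖ ≤ σ + ‖y - x‖ ^ 2 / (4 * σ) := by
        rw [← sub_nonneg]
        have : σ + ‖y - x‖ ^ 2 / (4 * σ) - ‖y - x‖ = (2 * σ - ‖y - x‖) ^ 2 / (4 * σ) := by
          field_simp; ring
        rw [this]; positivity
      linarith
    induction k with
    | zero =>
      intro y
      have : 0 ≤ n * (a * h ^ 2) / (2 * σ) := by positivity
      have := hbase y
      rw [w0]; linarith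
    | succ k ih =>
      intro y
      rw [wS, resolventStep, le_div_iff₀ hNpos]
      have hs : ∑ i, (2 * (u x - σ - n * (a * h ^ 2) / (2 * σ)) -
          (‖y - x + h • EuclideanSpace.basisFun (Fin n) ℝ i‖ ^ 2 +
          ‖y - x - h • EuclideanSpace.basisFun (Fin n) ℝ i‖ ^ 2) / (4 * σ)) ≤
          ∑ i, (w k (y + h • EuclideanSpace.basisFun (Fin n) ℝ i) +
          w k (y - h • EuclideanSpace.basisFun (Fin n) ℝ i)) := by
        refine Finset.sum_le_sum fun i _ => ?_
        have h1 := ih (y + h • EuclideanSpace.basisFun (Fin n) ℝ i)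
        have h2 := ih (y - h • EuclideanSpace.basisFun (Fin n) ℝ i)
        rw [add_sub_right_comm] at h1
        rw [sub_right_comm y] at h2
        rw [add_div]
        linarith
      rw [Finset.sum_sub_distrib, ← Finset.sum_div, sum_sq_norm_add_sub] at hs
      simp only [Finset.sum_const, Finset.card_univ, Fintype.card_fin, nsmul_eq_mul] at hs
      refine le_trans (le_of_eq ?_) (add_le_add (hbase y) (mul_le_mul_of_nonneg_left hs ha))
      rw [hN]; field_simp; ring
  obtain ⟨k, hk⟩ := exists_pow_lt_of_lt_one (show 0 < η / (N * (h + 1)) by positivity) hθ1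
  have hk' : N * (θ ^ k * h) ≤ η := by
    rw [lt_div_iff₀ (by positivity)] at hk
    have : 0 ≤ N * θ ^ k := by positivity
    nlinarith
  refine ⟨w k, hlip k, fun x => ?_, fun σ hσ x => ?_⟩
  · rw [sub_secondDiff_eq_resolventStep ha, ← wS, abs_mul, abs_of_pos hNpos]
    refine le_trans (mul_le_mul_of_nonneg_left ?_ hNpos.le) hk'
    rw [abs_le]; constructor <;> linarith [(hdist k x).1, (hdist k x).2]
  · have := hlow k σ hσ x x
    simp only [sub_self, norm_zero] at this
    norm_num at this
    linarith

/-! ### Mollification of Lipschitz functions -/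

theorem abs_second_difference_sub_le {φ φ' φ'' : ℝ → ℝ} {C h : ℝ} (hh : 0 ≤ h) (hC : 0 ≤ C)
    (h1 : ∀ t, HasDerivAt φ (φ' t) t) (h2 : ∀ t, HasDerivAt φ' (φ'' t) t)
    (h3 : ∀ t, |φ'' t - φ'' 0| ≤ C * |t|) :
    |φ h + φ (-h) - 2 * φ 0 - h ^ 2 * φ'' 0| ≤ 2 * C * h ^ 3 := by
  have hneg {g g' : ℝ → ℝ} (hg : ∀ t, HasDerivAt g (g' t) t) (t : ℝ) :
      HasDerivAt (fun t => g (-t)) (-g' (-t)) t := by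
    simpa [Function.comp_def] using (hg (-t)).comp t (hasDerivAt_neg t)
  have hsq (t : ℝ) : HasDerivAt (fun t : ℝ => t ^ 2 * φ'' 0) (2 * t * φ'' 0) t := by
    simpa using (hasDerivAt_pow 2 t).mul_const (φ'' 0)
  have hlin (t : ℝ) : HasDerivAt (fun t : ℝ => 2 * t * φ'' 0) (2 * φ'' 0) t := by
    simpa using ((hasDerivAt_id t).const_mul 2).mul_const (φ'' 0)
  have d1 (t : ℝ) : HasDerivAt (fun t => φ t + φ (-t) - 2 * φ 0 - t ^ 2 * φ'' 0)
      (φ' t + -φ' (-t) - 2 * t * φ'' 0) t :=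
    (((h1 t).add (hneg h1 t)).sub_const _).sub (hsq t)
  have d2 (t : ℝ) : HasDerivAt (fun t => φ' t + -φ' (-t) - 2 * t * φ'' 0)
      (φ'' t + - -φ'' (-t) - 2 * φ'' 0) t :=
    ((h2 t).add (hneg h2 t).neg).sub (hlin t)
  have b2 : ∀ t ∈ Set.Icc 0 h, |φ' t + -φ' (-t) - 2 * t * φ'' 0| ≤ 2 * C * h ^ 2 := by
    intro t ht
    have := (convex_Icc 0 h).norm_image_sub_le_of_norm_hasDerivWithin_le (C := 2 * C * h)
      (fun x _ => (d2 x).hasDerivWithinAt) (fun x hx => ?_) (Set.left_mem_Icc.2 hh) ht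
    · simp only [Real.norm_eq_abs, neg_zero, add_neg_cancel, mul_zero, zero_mul, sub_zero] at this
      refine this.trans ?_
      rw [abs_of_nonneg ht.1, pow_two, ← mul_assoc]
      gcongr
      exact ht.2
    · have e1 := abs_le.1 (h3 x)
      have e2 := abs_le.1 (h3 (-x))
      rw [abs_neg] at e2
      rw [abs_of_nonneg hx.1] at e1 e2
      have : C * x ≤ C * h := mul_le_mul_of_nonneg_left hx.2 hC
      rw [Real.norm_eq_abs, abs_le]
      constructor <;> linarith [e1.1, e1.2, e2.1, e2.2]
  have := (convex_Icc 0 h).norm_image_sub_le_of_norm_hasDerivWithin_le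
    (fun x _ => (d1 x).hasDerivWithinAt) b2 (Set.left_mem_Icc.2 hh) (Set.right_mem_Icc.2 hh)
  simp only [Real.norm_eq_abs, neg_zero, sub_zero, abs_of_nonneg hh] at this
  refine le_trans (le_of_eq ?_) (this.trans (le_of_eq (by ring)))
  congr 1
  ring


theorem continuous_of_sub_le_norm {w : EuclideanSpace ℝ (Fin n) → ℝ}
    (hw : ∀ x y, w x - w y ≤ ‖x - y‖) : Continuous w := by
  refine (LipschitzWith.of_dist_le_mul (K := 1) fun x y => ?_).continuous
  rw [NNReal.coe_one, one_mul, dist_eq_norm x y, Real.dist_eq, abs_le]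
  have := hw y x
  rw [norm_sub_rev] at this
  constructor <;> linarith [hw x y]

theorem integrable_smul_translate {ψ g : EuclideanSpace ℝ (Fin n) → ℝ} (hψ : Continuous ψ)
    (hcs : HasCompactSupport ψ) (hg : Continuous g) (x : EuclideanSpace ℝ (Fin n)) :
    Integrable fun t => ψ t • g (x - t) :=
  (hψ.smul (by fun_prop)).integrable_of_hasCompactSupport hcs.smul_right

theorem abs_convolution_sub_le {ψ g g' : EuclideanSpace ℝ (Fin n) → ℝ} (hψ : Continuous ψ)
    (hcs : HasCompactSupport ψ) (hg : Continuous g) (hg' : Continuous g')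
    {x x' : EuclideanSpace ℝ (Fin n)} {c : ℝ} (h : ∀ t, |g (x - t) - g' (x' - t)| ≤ c) :
    |(ψ ⋆ g) x - (ψ ⋆ g') x'| ≤ (∫ t, |ψ t|) * c := by
  simp only [convolution_def, ContinuousLinearMap.lsmul_apply]
  rw [← integral_sub (integrable_smul_translate hψ hcs hg x)
    (integrable_smul_translate hψ hcs hg' x'), ← integral_mul_const]
  refine norm_integral_le_of_norm_le (f := fun t => ψ t • g (x - t) - ψ t • g' (x' - t)) ?_ ?_
  · exact (hψ.abs.integrable_of_hasCompactSupport hcs.norm).mul_const c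
  · refine Eventually.of_forall fun t => ?_
    rw [← smul_sub, norm_smul]
    exact mul_le_mul_of_nonneg_left (h t) (norm_nonneg _)

theorem abs_convolution_sub_le_norm {ψ w : EuclideanSpace ℝ (Fin n) → ℝ} (hψ : Continuous ψ)
    (hcs : HasCompactSupport ψ) (hw : ∀ x y, w x - w y ≤ ‖x - y‖)
    (x x' : EuclideanSpace ℝ (Fin n)) :
    |(ψ ⋆ w) x - (ψ ⋆ w) x'| ≤ (∫ t, |ψ t|) * ‖x - x'‖ := by
  have hc := continuous_of_sub_le_norm hw
  refine abs_convolution_sub_le hψ hcs hc hc fun t => ?_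
  have h1 := hw (x - t) (x' - t)
  have h2 := hw (x' - t) (x - t)
  rw [sub_sub_sub_cancel_right] at h1 h2
  rw [norm_sub_rev] at h2
  rw [abs_le]; constructor <;> linarith

theorem fderiv_convolution_apply {ψ w : EuclideanSpace ℝ (Fin n) → ℝ} (hψ : ContDiff ℝ ∞ ψ)
    (hcs : HasCompactSupport ψ) (hw : Continuous w) (x e : EuclideanSpace ℝ (Fin n)) :
    fderiv ℝ (ψ ⋆ w) x e = ((fun t => fderiv ℝ ψ t e) ⋆ w) x := by
  have hψ1 : ContDiff ℝ 1 ψ := hψ.of_le (by exact_mod_cast le_top)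
  rw [(hcs.hasFDerivAt_convolution_left _ hψ1 hw.locallyIntegrable x).fderiv]
  have hi := (hcs.fderiv ℝ).convolutionExists_left
    ((ContinuousLinearMap.lsmul ℝ ℝ).precompL (EuclideanSpace ℝ (Fin n)))
    (hψ1.continuous_fderiv one_ne_zero) (hw.locallyIntegrable (μ := volume)) x
  rw [convolution_def, ContinuousLinearMap.integral_apply hi]
  rfl

/-- Consistency of the second difference with the Laplacian for mollified functions, with a constant
depending on the mollifier only: the second derivatives of `ρ ⋆ w` are convolutions of `w` with
second derivatives of `ρ`, hence Lipschitz uniformly in the `1`-Lipschitz function `w`. -/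
theorem exists_secondDiff_convolution_bound {ρ : EuclideanSpace ℝ (Fin n) → ℝ}
    (hρ : ContDiff ℝ ∞ ρ) (hcs : HasCompactSupport ρ) :
    ∃ C, 0 ≤ C ∧ ∀ w : EuclideanSpace ℝ (Fin n) → ℝ, (∀ x y, w x - w y ≤ ‖x - y‖) →
      ∀ h, 0 ≤ h → ∀ x, |secondDiff h (ρ ⋆ w) x - h ^ 2 * (Δ (ρ ⋆ w)) x| ≤ C * h ^ 3 := by
  have hsm {ψ : EuclideanSpace ℝ (Fin n) → ℝ} (hψ : ContDiff ℝ ∞ ψ)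
      (e : EuclideanSpace ℝ (Fin n)) : ContDiff ℝ ∞ fun t => fderiv ℝ ψ t e :=
    (hψ.fderiv_right (m := ∞) (by simp)).clm_apply contDiff_const
  set b := EuclideanSpace.basisFun (Fin n) ℝ
  set ρ₁ : Fin n → EuclideanSpace ℝ (Fin n) → ℝ := fun i t => fderiv ℝ ρ t (b i)
  set ρ₂ : Fin n → EuclideanSpace ℝ (Fin n) → ℝ := fun i t => fderiv ℝ (ρ₁ i) t (b i)
  have s1 (i) : ContDiff ℝ ∞ (ρ₁ i) := hsm hρ _
  have s2 (i) : ContDiff ℝ ∞ (ρ₂ i) := hsm (s1 i) _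
  have c1 (i) : HasCompactSupport (ρ₁ i) := hcs.fderiv_apply ℝ _
  have c2 (i) : HasCompactSupport (ρ₂ i) := (c1 i).fderiv_apply ℝ _
  refine ⟨∑ i, 2 * ∫ t, |ρ₂ i t|, Finset.sum_nonneg fun i _ => by positivity,
    fun w hw h hh x => ?_⟩
  have hwc := continuous_of_sub_le_norm hw
  have hcd {ψ : EuclideanSpace ℝ (Fin n) → ℝ} (hψ : ContDiff ℝ ∞ ψ) (hc : HasCompactSupport ψ) :
      ContDiff ℝ ∞ (ψ ⋆ w) := hc.contDiff_convolution_left _ hψ hwc.locallyIntegrable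
  have hline {ψ : EuclideanSpace ℝ (Fin n) → ℝ} (hψ : ContDiff ℝ ∞ ψ) (hc : HasCompactSupport ψ)
      (e : EuclideanSpace ℝ (Fin n)) (t : ℝ) : HasDerivAt (fun t : ℝ => (ψ ⋆ w) (x + t • e))
        (((fun y => fderiv ℝ ψ y e) ⋆ w) (x + t • e)) t := by
    rw [← fderiv_convolution_apply hψ hc hwc]
    have hd := ((hcd hψ hc).differentiable (by simp) (x + t • e)).hasFDerivAt
    have hl : HasDerivAt (fun t : ℝ => x + t • e) e t := by
      simpa using ((hasDerivAt_id t).smul_const e).const_add x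
    exact hd.comp_hasDerivAt t hl
  have hlap : (Δ (ρ ⋆ w)) x = ∑ i, (ρ₂ i ⋆ w) x := by
    rw [InnerProductSpace.laplacian_eq_iteratedFDeriv_orthonormalBasis _ b]
    refine Finset.sum_congr rfl fun i _ => ?_
    have h1 : (fun y => fderiv ℝ (ρ ⋆ w) y (b i)) = ρ₁ i ⋆ w :=
      funext fun y => fderiv_convolution_apply hρ hcs hwc y (b i)
    have hd : DifferentiableAt ℝ (fderiv ℝ (ρ ⋆ w)) x :=
      ((hcd hρ hcs).fderiv_right (m := 1) (by norm_cast)).differentiable one_ne_zero x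
    rw [iteratedFDeriv_two_apply]
    simp only [Matrix.cons_val_zero, Matrix.cons_val_one]
    rw [← fderiv_convolution_apply (s1 i) (c1 i) hwc x (b i), ← h1,
      fderiv_clm_apply hd (differentiableAt_const _)]
    simp
  rw [hlap, secondDiff, Finset.mul_sum, ← Finset.sum_sub_distrib, Finset.sum_mul]
  refine (Finset.abs_sum_le_sum_abs _ _).trans (Finset.sum_le_sum fun i _ => ?_)
  have := abs_second_difference_sub_le hh (integral_nonneg (μ := volume) fun t => abs_nonneg (ρ₂ i t))
    (hline hρ hcs (b i)) (hline (s1 i) (c1 i) (b i)) fun t => by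
      refine (abs_convolution_sub_le_norm (s2 i).continuous (c2 i) hw _ _).trans (le_of_eq ?_)
      simp [norm_smul, b.norm_eq_one]
  simpa [sub_eq_add_neg, b, ρ₂] using this

theorem convolution_secondDiff {ρ g : EuclideanSpace ℝ (Fin n) → ℝ} (hρ : Continuous ρ)
    (hcs : HasCompactSupport ρ) (hg : Continuous g) (h : ℝ) (x : EuclideanSpace ℝ (Fin n)) :
    (ρ ⋆ secondDiff h g) x = secondDiff h (ρ ⋆ g) x := by
  have hi := integrable_smul_translate hρ hcs hg
  have hi₂ (y z : EuclideanSpace ℝ (Fin n)) :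
      Integrable fun t => ρ t • g (y - t) + ρ t • g (z - t) := (hi y).add (hi z)
  have hi₃ (y z : EuclideanSpace ℝ (Fin n)) :
      Integrable fun t => ρ t • g (y - t) + ρ t • g (z - t) - 2 * (ρ t • g (x - t)) :=
    (hi₂ y z).sub ((hi x).const_mul 2)
  have hadd (y z : EuclideanSpace ℝ (Fin n)) :
      (ρ ⋆ g) y + (ρ ⋆ g) z - 2 * (ρ ⋆ g) x =
        ∫ t, (ρ t • g (y - t) + ρ t • g (z - t) - 2 * (ρ t • g (x - t))) := by
    rw [integral_sub (hi₂ y z) ((hi x).const_mul 2), integral_add (hi y) (hi z),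
      integral_const_mul]
    rfl
  simp only [secondDiff, hadd]
  rw [← integral_finsetSum _ fun i _ => hi₃ _ _]
  refine integral_congr_ae (Eventually.of_forall fun t => ?_)
  simp only [ContinuousLinearMap.lsmul_apply, smul_eq_mul, Finset.mul_sum, secondDiff]
  refine Finset.sum_congr rfl fun i _ => ?_
  rw [sub_add_eq_add_sub, sub_right_comm x t]
  ring

/-- Smooth approximate solutions `V` of `V - ε * Δ V = u` which are `1`-Lipschitz and satisfy a
one-sided bound on `u - V` that is small with `ε` (take `σ` of order `√ε`). They are mollifications
of the discrete approximate solutions; the mesh is chosen after the mollifier. -/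
theorem exists_smooth_resolvent {u : EuclideanSpace ℝ (Fin n) → ℝ}
    (hu : ∀ x y, u x - u y ≤ ‖x - y‖) {ε δ : ℝ} (hε : 0 < ε) (hδ : 0 < δ) :
    ∃ V : EuclideanSpace ℝ (Fin n) → ℝ, ContDiff ℝ ∞ V ∧ (∀ x y, V x - V y ≤ ‖x - y‖) ∧
      (∀ x, |V x - ε * (Δ V) x - u x| ≤ δ) ∧
      ∀ σ > 0, ∀ x, u x ≤ V x + σ + n * ε / (2 * σ) + δ := by
  let φ : ContDiffBump (0 : EuclideanSpace ℝ (Fin n)) :=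
    ⟨δ / 6, δ / 3, by positivity, by linarith⟩
  set ρ := φ.normed volume
  have hρ : ContDiff ℝ ∞ ρ := φ.contDiff_normed
  have hρc : Continuous ρ := hρ.continuous
  have hcs : HasCompactSupport ρ := φ.hasCompactSupport_normed
  have hint : ∫ t, |ρ t| = 1 := by
    simp only [ρ, abs_of_nonneg (φ.nonneg_normed _)]
    exact φ.integral_normed
  have hclose {g : EuclideanSpace ℝ (Fin n) → ℝ} (hg : ∀ x y, g x - g y ≤ ‖x - y‖) (x) :
      |(ρ ⋆ g) x - g x| ≤ δ / 3 := by
    rw [← Real.dist_eq]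
    refine φ.dist_normed_convolution_le (continuous_of_sub_le_norm hg).aestronglyMeasurable
      fun y hy => ?_
    have hy' : ‖y - x‖ < δ / 3 := by simpa [dist_eq_norm] using hy
    have h1 := hg y x
    have h2 := hg x y
    rw [norm_sub_rev] at h2
    rw [Real.dist_eq, abs_le]
    constructor <;> linarith
  obtain ⟨C, hC, hbound⟩ := exists_secondDiff_convolution_bound hρ hcs
  -- With `a * h ^ 2 = ε`, the consistency error `a * (C * h ^ 3) = ε * C * h` is at most `δ / 3`.
  set h := δ / (3 * ε * (C + 1)) with hh
  have hhpos : 0 < h := by positivity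
  set a := ε / h ^ 2 with ha
  have hapos : 0 < a := by positivity
  have hah : a * h ^ 2 = ε := by rw [ha]; field_simp
  obtain ⟨w, hw, hres, hlow⟩ :=
    exists_discrete_resolvent hu hapos.le hhpos.le (show 0 < δ / 3 by positivity)
  have hwc := continuous_of_sub_le_norm hw
  have huc := continuous_of_sub_le_norm hu
  have hLc : Continuous (secondDiff h w) := by unfold secondDiff; fun_prop
  refine ⟨ρ ⋆ w, hcs.contDiff_convolution_left _ hρ hwc.locallyIntegrable, fun x y => ?_,
    fun x => ?_, fun σ hσ x => ?_⟩
  · have := abs_convolution_sub_le_norm hρc hcs hw x y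
    rw [hint, one_mul] at this
    exact (le_abs_self _).trans this
  · have h1 : |(ρ ⋆ w) x - a * secondDiff h (ρ ⋆ w) x - (ρ ⋆ u) x| ≤ δ / 3 := by
      have h4 := abs_convolution_sub_le hρc hcs (hwc.sub (hLc.const_smul a)) huc
        (fun t => hres (x - t)) (x := x) (x' := x)
      rw [hint, one_mul] at h4
      rw [← convolution_secondDiff hρc hcs hwc]
      convert h4 using 3
      have hi := integrable_smul_translate hρc hcs hwc x
      have hi' := integrable_smul_translate hρc hcs hLc x
      simp only [convolution_def, ContinuousLinearMap.lsmul_apply]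
      rw [← integral_const_mul, ← integral_sub hi (hi'.const_mul a)]
      refine integral_congr_ae (Eventually.of_forall fun t => ?_)
      simp only [smul_eq_mul, Pi.sub_apply, Pi.smul_apply]
      ring
    have h2 := abs_le.1 (hclose hu x)
    have h3 := hbound w hw h hhpos.le x
    have h4 : |a * secondDiff h (ρ ⋆ w) x - ε * (Δ (ρ ⋆ w)) x| ≤ δ / 3 := by
      rw [← hah, mul_assoc, ← mul_sub, abs_mul, abs_of_pos hapos]
      refine (mul_le_mul_of_nonneg_left h3 hapos.le).trans ?_
      have : a * (C * h ^ 3) = (δ / 3) * (C / (C + 1)) := by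
        rw [ha, hh]; field_simp
      rw [this]
      refine mul_le_of_le_one_right (by positivity) ?_
      rw [div_le_one (by positivity)]; linarith
    have h1 := abs_le.1 h1
    have h4 := abs_le.1 h4
    rw [abs_le]; constructor <;> linarith [h1.1, h1.2, h2.1, h2.2, h4.1, h4.2]
  · have h1 := abs_le.1 (hclose hw x)
    have h2 := hlow σ hσ x
    rw [hah] at h2
    linarith [h1.1]

/-! ### Semicontinuous functions with prescribed growth -/

theorem UpperSemicontinuous.neg_lowerSemicontinuous {g : EuclideanSpace ℝ (Fin n) → ℝ}
    (hg : UpperSemicontinuous g) : LowerSemicontinuous fun x => -g x := fun z c hc =>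
  (hg z (-c) (by simpa using neg_lt_neg hc)).mono fun w hw => by simpa using neg_lt_neg hw

theorem exists_lower_bound_of_eventually {g : EuclideanSpace ℝ (Fin n) → ℝ}
    (hg : LowerSemicontinuous g) {c : ℝ}
    (h : ∀ᶠ x in cocompact (EuclideanSpace ℝ (Fin n)), c * ‖x‖ ≤ g x) :
    ∃ C, ∀ x, c * ‖x‖ - C ≤ g x := by
  obtain ⟨t, ht, hsub⟩ := mem_cocompact.1 h
  have hlsc : LowerSemicontinuous fun x => g x + -(c * ‖x‖) :=
    hg.add (by fun_prop : Continuous fun x : EuclideanSpace ℝ (Fin n) => -(c * ‖x‖)).lowerSemicontinuous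
  obtain ⟨m, hm⟩ := LowerSemicontinuousOn.bddBelow_of_isCompact ht (hlsc.lowerSemicontinuousOn t)
  refine ⟨|m|, fun x => ?_⟩
  by_cases hx : x ∈ t
  · have := hm (Set.mem_image_of_mem _ hx)
    linarith [neg_abs_le m]
  · have : c * ‖x‖ ≤ g x := hsub hx
    linarith [abs_nonneg m]

theorem exists_forall_le_of_coercive {g : EuclideanSpace ℝ (Fin n) → ℝ}
    (hg : LowerSemicontinuous g) {c C : ℝ} (hc : 0 < c) (h : ∀ x, c * ‖x‖ - C ≤ g x) :
    ∃ x₀, ∀ x, g x₀ ≤ g x := by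
  set R := (|C| + |g 0|) / c
  have hR : 0 ≤ R := by positivity
  obtain ⟨x₀, -, hx₀⟩ := LowerSemicontinuousOn.exists_isMinOn
    ⟨(0 : EuclideanSpace ℝ (Fin n)), Metric.mem_closedBall_self hR⟩
    (isCompact_closedBall 0 R) (hg.lowerSemicontinuousOn _)
  refine ⟨x₀, fun x => ?_⟩
  by_cases hx : x ∈ Metric.closedBall 0 R
  · exact hx₀ hx
  · have h0 : g x₀ ≤ g 0 := hx₀ (Metric.mem_closedBall_self hR)
    rw [mem_closedBall_zero_iff, not_le, div_lt_iff₀ hc] at hx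
    linarith [h x, le_abs_self C, le_abs_self (g 0)]

/-! ### Test functions -/

theorem norm_gradient_eq (φ : EuclideanSpace ℝ (Fin n) → ℝ) (x : EuclideanSpace ℝ (Fin n)) :
    ‖∇ φ x‖ = ‖fderiv ℝ φ x‖ := LinearIsometryEquiv.norm_map _ _

theorem hasFDerivAt_norm_sub_sq (x₀ x : EuclideanSpace ℝ (Fin n)) :
    HasFDerivAt (fun x => ‖x - x₀‖ ^ 2) ((2 : ℝ) • innerSL ℝ (x - x₀)) x := by
  have := ((hasFDerivAt_id x).sub_const x₀).norm_sq
  rwa [ContinuousLinearMap.comp_id, ← Nat.cast_smul_eq_nsmul ℝ] at this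

theorem laplacian_norm_sub_sq (x₀ x : EuclideanSpace ℝ (Fin n)) :
    (Δ fun x => ‖x - x₀‖ ^ 2) x = 2 * (n : ℝ) := by
  have h1 : fderiv ℝ (fun x : EuclideanSpace ℝ (Fin n) => ‖x - x₀‖ ^ 2) =
      fun x => (2 : ℝ) • innerSL ℝ (x - x₀) :=
    funext fun x => (hasFDerivAt_norm_sub_sq x₀ x).fderiv
  have h2 : HasFDerivAt (fun x : EuclideanSpace ℝ (Fin n) => (2 : ℝ) • innerSL ℝ (x - x₀))
      ((2 : ℝ) • innerSL ℝ) x :=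
    ((innerSL ℝ).hasFDerivAt.comp x ((hasFDerivAt_id x).sub_const x₀)).const_smul (2 : ℝ)
  rw [InnerProductSpace.laplacian_eq_iteratedFDeriv_orthonormalBasis _
    (EuclideanSpace.basisFun (Fin n) ℝ)]
  simp only [iteratedFDeriv_two_apply, h1, h2.fderiv]
  have (i : Fin n) : ((2 : ℝ) • innerSL ℝ) (EuclideanSpace.basisFun (Fin n) ℝ i)
      (EuclideanSpace.basisFun (Fin n) ℝ i) = 2 := by
    change (2 : ℝ) * inner ℝ (EuclideanSpace.basisFun (Fin n) ℝ i)
      (EuclideanSpace.basisFun (Fin n) ℝ i) = 2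
    rw [real_inner_self_eq_norm_sq, (EuclideanSpace.basisFun (Fin n) ℝ).norm_eq_one]
    norm_num
  simp only [Matrix.cons_val_zero, Matrix.cons_val_one, this, Finset.sum_const,
    Finset.card_univ, Fintype.card_fin, nsmul_eq_mul, mul_comm]

theorem laplacian_add_const_mul_norm_sub_sq {V : EuclideanSpace ℝ (Fin n) → ℝ}
    (hV : ContDiff ℝ 2 V) (K : ℝ) (x₀ x : EuclideanSpace ℝ (Fin n)) :
    (Δ fun x => V x + K * ‖x - x₀‖ ^ 2) x = (Δ V) x + 2 * n * K := by
  have hq : ContDiff ℝ 2 fun x : EuclideanSpace ℝ (Fin n) => ‖x - x₀‖ ^ 2 :=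
    (contDiff_id.sub contDiff_const).norm_sq ℝ
  have h1 := hV.contDiffAt.laplacian_add (x := x) (hq.const_smul K).contDiffAt
  have h2 := InnerProductSpace.laplacian_smul K (hq.contDiffAt (x := x))
  rw [laplacian_norm_sub_sq, smul_eq_mul] at h2
  exact h1.trans ((congrArg ((Δ V) x + ·) h2).trans (by ring))

/-! ### Properties of subsolutions -/

/-- The gradient constraint makes a subsolution `1`-Lipschitz. -/
theorem IsViscositySubsolution.sub_le_norm {f u : EuclideanSpace ℝ (Fin n) → ℝ} {lam : ℝ}
    (hu : IsViscositySubsolution f lam u)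
    (hgrowth : ∀ L > 1, ∃ C, ∀ x, u x ≤ L * ‖x‖ + C) (x y : EuclideanSpace ℝ (Fin n)) :
    u x - u y ≤ ‖x - y‖ := by
  have key (L : ℝ) (hL : 1 < L) : u x - u y ≤ L * ‖x - y‖ := by
    obtain ⟨L', hL1, hL'⟩ := exists_between hL
    obtain ⟨C, hC⟩ := hgrowth L' hL1
    have hlsc : LowerSemicontinuous fun z => L * ‖z - y‖ + -u z :=
      (by fun_prop : Continuous fun z => L * ‖z - y‖).lowerSemicontinuous.add
        hu.1.neg_lowerSemicontinuous
    obtain ⟨z, hz⟩ := exists_forall_le_of_coercive hlsc (sub_pos.2 hL') (C := C + L * ‖y‖)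
      fun w => by
        have h1 := norm_sub_norm_le w y
        have h2 := hC w
        nlinarith
    by_contra! hcon
    have hzx := hz x
    have hzy : z ≠ y := by
      rintro rfl
      simp only [sub_self, norm_zero, mul_zero] at hzx
      linarith
    set R := ‖z - y‖ with hR
    have hRpos : 0 < R := norm_pos_iff.2 (sub_ne_zero.2 hzy)
    -- The cone `L * ‖w - y‖` touches `u` from above at `z`, up to a constant. It is replaced by the
    -- paraboloid that touches it from above along the sphere of radius `R`; both have slope `L` there.
    have hφ : ContDiff ℝ 2 fun w : EuclideanSpace ℝ (Fin n) =>
        L / (2 * R) * ‖w - y‖ ^ 2 :=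
      contDiff_const.mul ((contDiff_id.sub contDiff_const).norm_sq ℝ)
    have hmax : IsLocalMax (fun w => u w - L / (2 * R) * ‖w - y‖ ^ 2) z := by
      refine Eventually.of_forall fun w => ?_
      have h1 := hz w
      have h2 : L * ‖w - y‖ ≤ L / (2 * R) * ‖w - y‖ ^ 2 + L * R / 2 := by
        rw [← sub_nonneg]
        have : L / (2 * R) * ‖w - y‖ ^ 2 + L * R / 2 - L * ‖w - y‖ =
          L / (2 * R) * (‖w - y‖ - R) ^ 2 := by field_simp; ring
        rw [this]; positivity
      have h3 : L / (2 * R) * R ^ 2 = L * R / 2 := by field_simp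
      simp only
      rw [← hR, h3]
      linarith
    have hle := (le_max_right _ _).trans (hu.2 z _ hφ hmax)
    rw [norm_gradient_eq, ((hasFDerivAt_norm_sub_sq y z).const_mul _).fderiv, norm_smul, norm_smul,
      innerSL_apply_norm, ← hR, Real.norm_of_nonneg (by positivity),
      Real.norm_of_nonneg (by positivity)] at hle
    have : L / (2 * R) * (2 * R) = L := by field_simp
    linarith
  refine le_of_forall_pos_le_add fun ε hε => ?_
  have hd : 0 < ‖x - y‖ + 1 := by positivity
  refine (key (1 + ε / (‖x - y‖ + 1)) (by linarith [div_pos hε hd])).trans ?_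
  have : ε / (‖x - y‖ + 1) * ‖x - y‖ ≤ ε := by
    rw [div_mul_eq_mul_div, div_le_iff₀ hd]; nlinarith
  linarith

/-- An approximate resolvent `V` of a subsolution `u` satisfies the inequality `lam - Δ V - f ≤ 0`
classically, up to small errors. As `Δ V` is nearly `(V - u) / ε`, this amounts to an upper bound for
`u - V` at `x₀`, which follows by testing the subsolution property at a maximum of
`u - V - K * ‖x - x₀‖ ^ 2`. The term with `K` makes the estimate local: only values of `f` on the ball
of radius `r` around `x₀` enter. -/
theorem IsViscositySubsolution.le_laplacian_resolvent {f u V : EuclideanSpace ℝ (Fin n) → ℝ}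
    {lam ε δ M K r γ : ℝ} (hu : IsViscositySubsolution f lam u) (hV : ContDiff ℝ 2 V)
    (hε : 0 < ε) (hδ : 0 ≤ δ) (hr : 0 ≤ r) (hK : 0 < K) (hres : ∀ x, |V x - ε * (Δ V) x - u x| ≤ δ)
    (hM : ∀ x, u x ≤ V x + M) (hKr : M + ε * γ ≤ K * r ^ 2)
    {x₀ : EuclideanSpace ℝ (Fin n)} (hγ : ∀ x, ‖x - x₀‖ ≤ r → γ ≤ lam - f x) :
    γ - 2 * n * K - 2 * δ / ε ≤ (Δ V) x₀ := by
  have hlsc : LowerSemicontinuous fun x => V x + K * ‖x - x₀‖ ^ 2 + -u x :=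
    (by have := hV.continuous; fun_prop :
      Continuous fun x => V x + K * ‖x - x₀‖ ^ 2).lowerSemicontinuous.add
      hu.1.neg_lowerSemicontinuous
  obtain ⟨x₁, hx₁⟩ := exists_forall_le_of_coercive hlsc (c := 2 * K)
    (C := M + K * (2 * ‖x₀‖ + 1)) (by positivity) fun x => by
      have h1 := hM x
      have h2 := norm_sub_norm_le x x₀
      nlinarith [sq_nonneg (‖x - x₀‖ - 1)]
  have htest : ContDiff ℝ 2 fun x => V x + K * ‖x - x₀‖ ^ 2 :=
    hV.add (contDiff_const.mul ((contDiff_id.sub contDiff_const).norm_sq ℝ))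
  have hsub := (le_max_left _ _).trans (hu.2 x₁ _ htest
    (Eventually.of_forall fun x => by have := hx₁ x; simp only; linarith))
  rw [laplacian_add_const_mul_norm_sub_sq hV] at hsub
  have h0 := hx₁ x₀
  simp only [sub_self, norm_zero] at h0
  have hbound : u x₀ - V x₀ ≤ δ - ε * γ + 2 * n * K * ε := by
    have hnK : 0 ≤ 2 * n * K * ε := by positivity
    rcases le_total ‖x₁ - x₀‖ r with hle | hle
    · have h1 := (abs_le.1 (hres x₁)).1
      have h2 := hγ x₁ hle
      have h3 : ε * (γ - 2 * n * K) ≤ ε * (Δ V) x₁ :=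
        mul_le_mul_of_nonneg_left (by linarith) hε.le
      have h4 : 0 ≤ K * ‖x₁ - x₀‖ ^ 2 := by positivity
      linarith
    · have h1 := hM x₁
      have h2 : K * r ^ 2 ≤ K * ‖x₁ - x₀‖ ^ 2 := by gcongr
      linarith
  have h1 := (abs_le.1 (hres x₀)).2
  have h2 : ε * (γ - 2 * n * K - 2 * δ / ε) = ε * γ - 2 * n * K * ε - 2 * δ := by
    field_simp
  refine le_of_mul_le_mul_left ?_ hε
  rw [h2]
  linarith

/-! ### Comparison of eigenvalues -/

/-- The comparison principle, with the growth conditions as affine bounds. -/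
theorem eigenvalue_le_of_growth {f u v : EuclideanSpace ℝ (Fin n) → ℝ} {lam mu m : ℝ}
    (hf : Continuous f) (hm : ∀ x, m ≤ f x)
    (hu : IsViscositySubsolution f lam u) (hv : IsViscositySupersolution f mu v)
    (hugrowth : ∀ L > 1, ∃ C, ∀ x, u x ≤ L * ‖x‖ + C)
    (hvgrowth : ∀ c < 1, ∃ C, ∀ x, c * ‖x‖ - C ≤ v x) : lam ≤ mu := by
  have hlip := hu.sub_le_norm hugrowth
  have key (τ : ℝ) (hτ0 : 0 < τ) (hτ1 : τ < 1) (η : ℝ) (hη : 0 < η) :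
      τ * lam + (1 - τ) * m ≤ mu + 3 * η := by
    obtain ⟨c, hτc, hc1⟩ := exists_between hτ1
    obtain ⟨C, hC⟩ := hvgrowth c hc1
    -- Minimum points of `v - τ * V` lie in the ball of radius `R`, for every `1`-Lipschitz `V`.
    set R := (C + v 0) / (c - τ) with hR
    obtain ⟨r, hr0, hr⟩ : ∃ r > 0, ∀ x y : EuclideanSpace ℝ (Fin n), ‖y‖ ≤ R →
        ‖x - y‖ ≤ r → f x ≤ f y + η := by
      have huc := (isCompact_closedBall (0 : EuclideanSpace ℝ (Fin n)) (R + 1)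
        ).uniformContinuousOn_of_continuous hf.continuousOn
      obtain ⟨d, hd, hdd⟩ := Metric.uniformContinuousOn_iff.1 huc η hη
      refine ⟨min 1 (d / 2), by positivity, fun x y hy hxy => ?_⟩
      have h1 : ‖x‖ ≤ R + 1 := by
        have := norm_le_norm_add_norm_sub' x y
        linarith [hxy.trans (min_le_left _ _)]
      have := hdd x (by simpa using h1) y (by simp; linarith)
        (by rw [dist_eq_norm]; linarith [hxy.trans (min_le_right _ _)])
      rw [Real.dist_eq] at this
      linarith [(abs_lt.1 this).2]
    set Γ := |lam| + |m|
    -- `K` is small against `η` first; then `ε` and `δ` so that `u - V` is at most of order `K * r ^ 2`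
    -- and `δ` is small against `ε`.
    set K := η / (2 * n + 1) with hK
    have hKpos : 0 < K := by positivity
    have hnK : 2 * n * K ≤ η := by
      rw [hK, mul_div_assoc', div_le_iff₀ (by positivity)]; nlinarith
    set s := K * r ^ 2 / 3 with hs
    have hspos : 0 < s := by positivity
    set ε := s / (n / (2 * s) + Γ + 1) with hε
    have hεpos : 0 < ε := by positivity
    have hεs : n * ε / (2 * s) + ε * Γ ≤ s := by
      have : ε * (n / (2 * s) + Γ + 1) = s :=
        div_mul_cancel₀ _ (by positivity)
      have h2 : n * ε / (2 * s) = ε * (n / (2 * s)) := by ring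
      rw [h2]; nlinarith
    set δ := min s (ε * η / 2)
    have hδpos : 0 < δ := by positivity
    obtain ⟨V, hVs, hVlip, hVres, hVlow⟩ := exists_smooth_resolvent hlip hεpos hδpos
    have hV2 : ContDiff ℝ 2 V := mod_cast contDiff_infty.1 hVs 2
    have hvlsc : LowerSemicontinuous fun x => v x + -(τ * V x) :=
      hv.1.add (by have := hVs.continuous; fun_prop :
        Continuous fun x => -(τ * V x)).lowerSemicontinuous
    have hVgrowth (x) : τ * V x ≤ τ * V 0 + τ * ‖x‖ := by
      have := hVlip x 0
      rw [sub_zero] at this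
      nlinarith
    obtain ⟨y, hy⟩ := exists_forall_le_of_coercive hvlsc (sub_pos.2 hτc) (C := C + τ * V 0)
      fun x => by linarith [hC x, hVgrowth x]
    have hyR : ‖y‖ ≤ R := by
      rw [hR, le_div_iff₀ (sub_pos.2 hτc)]
      linarith [hC y, hVgrowth y, hy 0]
    have hlap := hu.le_laplacian_resolvent (γ := lam - f y - η) (M := s + n * ε / (2 * s) + δ)
      (r := r) hV2 hεpos hδpos.le hr0.le hKpos hVres
      (fun x => by linarith [hVlow s hspos x])
      (by
        have h1 : lam - f y - η ≤ Γ := by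
          linarith [le_abs_self lam, neg_abs_le m, hm y]
        have h2 := mul_le_mul_of_nonneg_left h1 hεpos.le
        have h3 : δ ≤ s := min_le_left _ _
        have h4 : K * r ^ 2 = 3 * s := by rw [hs]; ring
        linarith)
      (x₀ := y) fun x hx => by linarith [hr x y hyR hx]
    have hδε : 2 * δ / ε ≤ η := by
      rw [div_le_iff₀ hεpos]
      linarith [min_le_right s (ε * η / 2)]
    have hsup := hv.2 y (fun x => τ * V x) (contDiff_const.mul hV2)
      (Eventually.of_forall fun x => by have := hy x; simp only; linarith)
    -- As `τ < 1`, the gradient constraint is inactive for the test function `τ * V`.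
    have hgrad : ‖∇ (fun x => τ * V x) y‖ < 1 := by
      have hL : LipschitzWith 1 V := LipschitzWith.of_le_add fun x z => by
        rw [dist_eq_norm x z]; linarith [hVlip x z]
      have h1 : ‖fderiv ℝ V y‖ ≤ 1 := by simpa using norm_fderiv_le_of_lipschitz ℝ hL (x₀ := y)
      rw [norm_gradient_eq, fderiv_const_mul (hV2.differentiable two_ne_zero y), norm_smul,
        Real.norm_of_nonneg hτ0.le]
      nlinarith
    have hsup' : 0 ≤ mu - (Δ fun x => τ * V x) y - f y := by
      rcases le_max_iff.1 hsup with h | h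
      · exact h
      · linarith
    have hsmul : (Δ fun x => τ * V x) y = τ * (Δ V) y :=
      InnerProductSpace.laplacian_smul τ hV2.contDiffAt
    rw [hsmul] at hsup'
    have h1 : τ * (lam - f y - 3 * η) ≤ τ * (Δ V) y :=
      mul_le_mul_of_nonneg_left (by linarith) hτ0.le
    have h2 : (1 - τ) * m ≤ (1 - τ) * f y := mul_le_mul_of_nonneg_left (hm y) (by linarith)
    have h3 : τ * (3 * η) ≤ 3 * η := mul_le_of_le_one_left (by positivity) hτ1.le
    linarith
  have key' (τ : ℝ) (hτ0 : 0 < τ) (hτ1 : τ < 1) : τ * lam + (1 - τ) * m ≤ mu :=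
    le_of_forall_pos_le_add fun η hη => by
      have := key τ hτ0 hτ1 (η / 3) (by positivity)
      linarith
  have hlim : Tendsto (fun τ : ℝ => τ * lam + (1 - τ) * m) (𝓝[<] 1) (𝓝 lam) := by
    have : Continuous fun τ : ℝ => τ * lam + (1 - τ) * m := by fun_prop
    simpa using (this.tendsto 1).mono_left nhdsWithin_le_nhds
  refine le_of_tendsto hlim ?_
  filter_upwards [Ioo_mem_nhdsLT zero_lt_one] with τ hτ using key' τ hτ.1 hτ.2

theorem eigenvalue_le {f u v : EuclideanSpace ℝ (Fin n) → ℝ} {lam mu : ℝ}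
    (hf : Continuous f)
    (hf_growth : Tendsto (fun x => f x / ‖x‖) (cocompact (EuclideanSpace ℝ (Fin n))) atTop)
    (hu : IsViscositySubsolution f lam u) (hv : IsViscositySupersolution f mu v)
    (hlimsup :
      limsup (fun x => ((u x / ‖x‖ : ℝ) : EReal)) (cocompact (EuclideanSpace ℝ (Fin n))) ≤ 1)
    (hliminf :
      1 ≤ liminf (fun x => ((v x / ‖x‖ : ℝ) : EReal)) (cocompact (EuclideanSpace ℝ (Fin n)))) :
    lam ≤ mu := by
  have hne : ∀ᶠ x in cocompact (EuclideanSpace ℝ (Fin n)), 0 < ‖x‖ :=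
    mem_cocompact.2 ⟨{0}, isCompact_singleton, fun x hx => norm_pos_iff.2 hx⟩
  obtain ⟨C, hC⟩ := exists_lower_bound_of_eventually (c := 0) hf.lowerSemicontinuous (by
    filter_upwards [hne, hf_growth.eventually_ge_atTop 0] with x hx h
    rwa [le_div_iff₀ hx] at h)
  refine eigenvalue_le_of_growth (m := -C) hf (fun x => by linarith [hC x]) hu hv
    (fun L hL => ?_) fun c hc => ?_
  · have hlt : limsup (fun x => ((u x / ‖x‖ : ℝ) : EReal))
        (cocompact (EuclideanSpace ℝ (Fin n))) < (L : EReal) :=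
      hlimsup.trans_lt (by exact_mod_cast hL)
    obtain ⟨C, hC⟩ := exists_lower_bound_of_eventually (g := fun x => -u x) (c := -L)
      hu.1.neg_lowerSemicontinuous (by
        filter_upwards [hne, eventually_lt_of_limsup_lt hlt] with x hx h
        have := (div_lt_iff₀ hx).1 (EReal.coe_lt_coe_iff.1 h)
        linarith)
    exact ⟨C, fun x => by linarith [hC x]⟩
  · have hlt : (c : EReal) < liminf (fun x => ((v x / ‖x‖ : ℝ) : EReal))
        (cocompact (EuclideanSpace ℝ (Fin n))) :=
      lt_of_lt_of_le (by exact_mod_cast hc) hliminf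
    refine exists_lower_bound_of_eventually hv.1 ?_
    filter_upwards [hne, eventually_lt_of_lt_liminf hlt] with x hx h
    exact ((lt_div_iff₀ hx).1 (EReal.coe_lt_coe_iff.1 h)).le

/-- For `l = ⊥` (the cocompact filter when `n = 0`) the two sides are `⊥` and `⊤`. -/
theorem limsup_le_and_le_liminf_of_tendsto {α : Type*} {l : Filter α} {g : α → ℝ} {a : ℝ}
    (h : Tendsto g l (𝓝 a)) :
    limsup (fun x => (g x : EReal)) l ≤ a ∧ (a : EReal) ≤ liminf (fun x => (g x : EReal)) l := by
  rcases l.eq_or_neBot with rfl | hl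
  · simp
  · have h' : Tendsto (fun x => (g x : EReal)) l (𝓝 (a : EReal)) :=
      (continuous_coe_real_ereal.tendsto a).comp h
    exact ⟨h'.limsup_eq.le, h'.liminf_eq.ge⟩

end

theorem proposition2p3 (n : ℕ) (f : EuclideanSpace ℝ (Fin n) → ℝ)
    (hf_smooth : ContDiff ℝ ∞ f) (hf_convex : ConvexOn ℝ Set.univ f)
    (hf_growth : Tendsto (fun x => f x / ‖x‖) (cocompact (EuclideanSpace ℝ (Fin n))) atTop) :
    (∀ (lam mu : ℝ) (u v : EuclideanSpace ℝ (Fin n) → ℝ),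
      IsViscositySubsolution f lam u →
      IsViscositySupersolution f mu v →
      limsup (fun x => ((u x / ‖x‖ : ℝ) : EReal)) (cocompact (EuclideanSpace ℝ (Fin n))) ≤ 1 →
      1 ≤ liminf (fun x => ((v x / ‖x‖ : ℝ) : EReal)) (cocompact (EuclideanSpace ℝ (Fin n))) →
      lam ≤ mu) ∧
    (∀ (lam mu : ℝ),
      (∃ u : EuclideanSpace ℝ (Fin n) → ℝ, IsViscositySolution f lam u ∧
        Tendsto (fun x => u x / ‖x‖) (cocompact (EuclideanSpace ℝ (Fin n))) (𝓝 1)) →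
      (∃ v : EuclideanSpace ℝ (Fin n) → ℝ, IsViscositySolution f mu v ∧
        Tendsto (fun x => v x / ‖x‖) (cocompact (EuclideanSpace ℝ (Fin n))) (𝓝 1)) →
      lam = mu) := by
  have hf := hf_smooth.continuous
  refine ⟨fun lam mu u v hu hv => eigenvalue_le hf hf_growth hu hv, ?_⟩
  rintro lam mu ⟨u, ⟨-, husub, husuper⟩, hulim⟩ ⟨v, ⟨-, hvsub, hvsuper⟩, hvlim⟩
  obtain ⟨hu1, hu2⟩ := limsup_le_and_le_liminf_of_tendsto hulim
  obtain ⟨hv1, hv2⟩ := limsup_le_and_le_liminf_of_tendsto hvlim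
  exact le_antisymm
    (eigenvalue_le hf hf_growth husub hvsuper (by simpa using hu1) (by simpa using hv2))
    (eigenvalue_le hf hf_growth hvsub husuper (by simpa using hv1) (by simpa using hu2))
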